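/- Let $d\ge 3$. For $n\in\mathbb N$ define the following, where each maximum is taken over all sets of $n$ points in $\mathbb R^d$ and all strictly convex norms on $\mathbb R^d$: $W_d(n)$ is the maximum number of pairwise nonparallel segments of unit length with endpoints in the set; $U_d(n)$ is the maximum number of unordered pairs of points of the set at distance $1$; $D_d(n)$ is the maximum number of unordered pairs of distinct points of the set whose distance equals the diameter of the set (distances and diameter being measured in the norm). A family $(A_i)_{i\in I}$ of sets of points in $\mathbb R^d$ is called strictly antipodal if for any $i\ne j$ in $I$ and any $p\in A_i$, $q\in A_j$ there is a linear functional $\varphi:\mathbb R^d\to\mathbb R$ such that $\varphi(p)<\varphi(r)<\varphi(q)$ for every $r\in\bigcup_{l\in I}A_l\setminus\{p,q\}$. Then there is a largest integer $k$ such that for each $m$ there exists a strictly antipodal family of $k$ sets in $\mathbb R^d$, each of size at least $m$; and, denoting it by $a(d)$, \[\lim_{n\to\infty}\frac{W_d(n)}{n^2}=\lim_{n\to\infty}\frac{U_d(n)}{n^2}=\lim_{n\to\infty}\frac{D_d(n)}{n^2}=\frac12\left(1-\frac1{a(d)}\right),\] where all three limits exist. -/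

import Mathlib

open Filter Topology

noncomputable section

/-- `ℝ^d` as a real vector space. (Its Euclidean norm plays no role in the definitions below;
the norms that matter are the seminorms `N` with `IsStrictlyConvexNorm N`.) -/
abbrev Rd (d : ℕ) : Type := EuclideanSpace ℝ (Fin d)

/-- `N` is a strictly convex norm on `ℝ^d`: it is definite, and its unit sphere contains no
midpoint of two distinct points of the unit sphere. -/
structure IsStrictlyConvexNorm {d : ℕ} (N : Seminorm ℝ (Rd d)) : Prop where
  eq_zero_of_map_eq_zero : ∀ x, N x = 0 → x = 0
  map_add_lt_two : ∀ x y, N x = 1 → N y = 1 → x ≠ y → N (x + y) < 2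

/-- The length `N (p - q)` of the segment with unordered pair of endpoints `s(p, q)`. -/
def pairLength {d : ℕ} (N : Seminorm ℝ (Rd d)) : Sym2 (Rd d) → ℝ :=
  Sym2.lift ⟨fun p q => N (p - q), fun p q => map_sub_rev N p q⟩

/-- The direction (linear span of the difference of the endpoints) of the segment with unordered
pair of endpoints `s(p, q)`. Two nondegenerate segments are parallel iff their directions are
equal. -/
def pairDirection {d : ℕ} : Sym2 (Rd d) → Submodule ℝ (Rd d) :=
  Sym2.lift ⟨fun p q => Submodule.span ℝ {p - q}, fun p q => by
    change Submodule.span ℝ {p - q} = Submodule.span ℝ {q - p}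
    rw [← neg_sub q p, ← Set.neg_singleton, Submodule.span_neg]⟩

/-- The diameter of a finite point set with respect to `N`. -/
def normDiam {d : ℕ} (N : Seminorm ℝ (Rd d)) (P : Finset (Rd d)) : ℝ :=
  sSup (pairLength N '' (P.sym2 : Set (Sym2 (Rd d))))

open Classical in
/-- The unordered pairs of points of `P` at `N`-distance one. -/
def unitPairs {d : ℕ} (N : Seminorm ℝ (Rd d)) (P : Finset (Rd d)) : Finset (Sym2 (Rd d)) :=
  P.sym2.filter fun e => pairLength N e = 1

open Classical in
/-- The unordered pairs of distinct points of `P` whose `N`-distance is the diameter of `P`. -/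
def diameterPairs {d : ℕ} (N : Seminorm ℝ (Rd d)) (P : Finset (Rd d)) : Finset (Sym2 (Rd d)) :=
  P.sym2.filter fun e => ¬ e.IsDiag ∧ pairLength N e = normDiam N P

/-- `W_d(n)`: the maximum number of pairwise nonparallel segments of unit length among a set of
`n` points in `ℝ^d`, over all such sets and all strictly convex norms. -/
def maxNonparallelUnitPairs (d n : ℕ) : ℕ :=
  sSup {m | ∃ N : Seminorm ℝ (Rd d), IsStrictlyConvexNorm N ∧
    ∃ P : Finset (Rd d), P.card = n ∧
      ∃ F : Finset (Sym2 (Rd d)), F ⊆ unitPairs N P ∧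
        (F : Set (Sym2 (Rd d))).Pairwise (fun e f => pairDirection e ≠ pairDirection f) ∧
        F.card = m}

/-- `U_d(n)`: the maximum number of unit distance pairs among a set of `n` points in `ℝ^d`, over
all such sets and all strictly convex norms. -/
def maxUnitPairs (d n : ℕ) : ℕ :=
  sSup {m | ∃ N : Seminorm ℝ (Rd d), IsStrictlyConvexNorm N ∧
    ∃ P : Finset (Rd d), P.card = n ∧ (unitPairs N P).card = m}

/-- `D_d(n)`: the maximum number of diameter pairs of a set of `n` points in `ℝ^d`, over all such
sets and all strictly convex norms. -/
def maxDiameterPairs (d n : ℕ) : ℕ :=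
  sSup {m | ∃ N : Seminorm ℝ (Rd d), IsStrictlyConvexNorm N ∧
    ∃ P : Finset (Rd d), P.card = n ∧ (diameterPairs N P).card = m}

/-- A family of sets is strictly antipodal if any two points `p`, `q` in members of the family
with different indices are strictly separated from all other points of the union by a pair of
parallel hyperplanes through `p` and `q`. -/
def StrictlyAntipodal {d : ℕ} {ι : Type*} (A : ι → Set (Rd d)) : Prop :=
  ∀ i j, i ≠ j → ∀ p ∈ A i, ∀ q ∈ A j, ∃ φ : Rd d →ₗ[ℝ] ℝ,
    ∀ r ∈ (⋃ l, A l) \ {p, q}, φ p < φ r ∧ φ r < φ q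

/-- The numbers `k` such that for each `m` there is a strictly antipodal family of `k` sets in
`ℝ^d`, each of size at least `m`. -/
def antipodalSizes (d : ℕ) : Set ℕ :=
  {k | ∀ m : ℕ, ∃ A : Fin k → Set (Rd d), StrictlyAntipodal A ∧ ∀ i, (m : ℕ∞) ≤ (A i).encard}

/-- `a(d)`: the largest element of `antipodalSizes d`. -/
def antipodalNumber (d : ℕ) : ℕ := sSup (antipodalSizes d)

/-- The Euclidean norm is a strictly convex norm. -/
theorem isStrictlyConvexNorm_normSeminorm (d : ℕ) :
    IsStrictlyConvexNorm (normSeminorm ℝ (Rd d)) where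
  eq_zero_of_map_eq_zero := fun x hx => norm_eq_zero.mp hx
  map_add_lt_two := fun x y hx hy hxy => by
    have hx' : ‖x‖ = 1 := hx
    have hy' : ‖y‖ = 1 := hy
    change ‖x + y‖ < 2
    have h := parallelogram_law_with_norm ℝ x y
    have h0 : 0 < ‖x - y‖ := norm_pos_iff.mpr (sub_ne_zero.mpr hxy)
    rw [hx', hy'] at h
    nlinarith [norm_nonneg (x + y)]

/-- The maximum in the definition of `W_d(n)` is attained. -/
theorem isGreatest_maxNonparallelUnitPairs {d : ℕ} (hd : 1 ≤ d) (n : ℕ) :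
    IsGreatest {m | ∃ N : Seminorm ℝ (Rd d), IsStrictlyConvexNorm N ∧
      ∃ P : Finset (Rd d), P.card = n ∧
        ∃ F : Finset (Sym2 (Rd d)), F ⊆ unitPairs N P ∧
          (F : Set (Sym2 (Rd d))).Pairwise (fun e f => pairDirection e ≠ pairDirection f) ∧
          F.card = m} (maxNonparallelUnitPairs d n) := by
  have : Nonempty (Fin d) := ⟨⟨0, hd⟩⟩
  obtain ⟨P, hP⟩ := Infinite.exists_subset_card_eq (Rd d) n
  have hb : BddAbove {m | ∃ N : Seminorm ℝ (Rd d), IsStrictlyConvexNorm N ∧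
      ∃ P : Finset (Rd d), P.card = n ∧
        ∃ F : Finset (Sym2 (Rd d)), F ⊆ unitPairs N P ∧
          (F : Set (Sym2 (Rd d))).Pairwise (fun e f => pairDirection e ≠ pairDirection f) ∧
          F.card = m} := by
    refine ⟨(n + 1).choose 2, ?_⟩
    rintro m ⟨N, -, P, rfl, F, hF, -, rfl⟩
    exact (Finset.card_le_card (hF.trans (Finset.filter_subset _ _))).trans P.card_sym2.le
  exact ⟨Nat.sSup_mem ⟨0, normSeminorm ℝ (Rd d), isStrictlyConvexNorm_normSeminorm d, P, hP, ∅,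
    by simp⟩ hb, fun m hm => le_csSup hb hm⟩

/-- The maximum in the definition of `U_d(n)` is attained. -/
theorem isGreatest_maxUnitPairs {d : ℕ} (hd : 1 ≤ d) (n : ℕ) :
    IsGreatest {m | ∃ N : Seminorm ℝ (Rd d), IsStrictlyConvexNorm N ∧
      ∃ P : Finset (Rd d), P.card = n ∧ (unitPairs N P).card = m} (maxUnitPairs d n) := by
  have : Nonempty (Fin d) := ⟨⟨0, hd⟩⟩
  obtain ⟨P, hP⟩ := Infinite.exists_subset_card_eq (Rd d) n
  have hb : BddAbove {m | ∃ N : Seminorm ℝ (Rd d), IsStrictlyConvexNorm N ∧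
      ∃ P : Finset (Rd d), P.card = n ∧ (unitPairs N P).card = m} := by
    refine ⟨(n + 1).choose 2, ?_⟩
    rintro m ⟨N, -, P, rfl, rfl⟩
    exact (Finset.card_le_card (Finset.filter_subset _ _)).trans P.card_sym2.le
  exact ⟨Nat.sSup_mem ⟨_, normSeminorm ℝ (Rd d), isStrictlyConvexNorm_normSeminorm d, P, hP, rfl⟩
    hb, fun m hm => le_csSup hb hm⟩

/-- The maximum in the definition of `D_d(n)` is attained. -/
theorem isGreatest_maxDiameterPairs {d : ℕ} (hd : 1 ≤ d) (n : ℕ) :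
    IsGreatest {m | ∃ N : Seminorm ℝ (Rd d), IsStrictlyConvexNorm N ∧
      ∃ P : Finset (Rd d), P.card = n ∧ (diameterPairs N P).card = m} (maxDiameterPairs d n) := by
  have : Nonempty (Fin d) := ⟨⟨0, hd⟩⟩
  obtain ⟨P, hP⟩ := Infinite.exists_subset_card_eq (Rd d) n
  have hb : BddAbove {m | ∃ N : Seminorm ℝ (Rd d), IsStrictlyConvexNorm N ∧
      ∃ P : Finset (Rd d), P.card = n ∧ (diameterPairs N P).card = m} := by
    refine ⟨(n + 1).choose 2, ?_⟩
    rintro m ⟨N, -, P, rfl, rfl⟩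
    exact (Finset.card_le_card (Finset.filter_subset _ _)).trans P.card_sym2.le
  exact ⟨Nat.sSup_mem ⟨_, normSeminorm ℝ (Rd d), isStrictlyConvexNorm_normSeminorm d, P, hP, rfl⟩
    hb, fun m hm => le_csSup hb hm⟩

end

/-! ### Erdős–Stone bound on extremal numbers -/

/-! Write `a` for the antipodal number. For the upper bound, suppose a unit distance graph contains
a complete `(a + 1)`-partite graph with huge classes. Each class lies in a unit ball about a point
of another class, so by packing it has a large subset of diameter below one. Strict convexity makes
a functional supporting the ball at `q - p` separate `p` and `q` strictly from all other chosen
points (`IsStrictlyConvexNorm.strictlyAntipodal`), so these subsets form a strictly antipodal family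
that is too large. Erdős–Stone then bounds the number of edges.

For the lower bound, spread `n` points over a strictly antipodal family of `a` sets. Each cross pair
has a functional equal to 1 on its difference and below 1 in absolute value on all differences of
other pairs. A suitable ellipsoidal norm for each cross pair, and the maximum of these, give a
strictly convex norm in which cross distances are 1 and no distance exceeds 1
(`StrictlyAntipodal.exists_norm`). Cross segments are never parallel, so one configuration realizes
the Turán graph for all three problems. -/

theorem extremalNumber_completeEquipartiteGraph_succ_le {ε : ℝ} (hε : 0 < ε) (r t : ℕ) :
    ∀ᶠ n : ℕ in atTop,
      (SimpleGraph.extremalNumber (n + 1) (SimpleGraph.completeEquipartiteGraph (r + 1) t) : ℝ) ≤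
        SimpleGraph.extremalNumber n (SimpleGraph.completeEquipartiteGraph (r + 1) t) +
          (1 - 1 / r + ε) * (n + 1 : ℕ) := by
  have h := SimpleGraph.eventually_completeEquipartiteGraph_isContained_of_minDegree hε r t
  filter_upwards [(tendsto_add_atTop_nat 1).eventually h, eventually_ge_atTop ⌈1 / ε⌉₊] with n hn hnε
  set H := SimpleGraph.completeEquipartiteGraph (r + 1) t
  have hnε' : 1 ≤ ε * n := by
    have := (div_le_iff₀ hε).1 ((Nat.le_ceil _).trans (Nat.cast_le.2 hnε))
    linarith
  have hc : (0 : ℝ) ≤ 1 - 1 / r := by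
    rcases Nat.eq_zero_or_pos r with rfl | hr
    · simp
    · have : (1 : ℝ) / r ≤ 1 := by
        rw [div_le_one (by positivity)]; exact_mod_cast hr
      linarith
  have hpos : (0 : ℝ) ≤ (SimpleGraph.extremalNumber n H : ℝ) + (1 - 1 / r + ε) * (n + 1 : ℕ) := by
    positivity
  have key := (SimpleGraph.extremalNumber_le_iff_of_nonneg (V := Fin (n + 1)) H hpos).2
  rw [Fintype.card_fin] at key
  apply key
  intro G _ hG
  -- The minimum-degree form of Erdős–Stone forces a vertex of small degree in a graph avoiding `H`;
  -- deleting it leaves an extremal problem on `n` vertices.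
  have hmin : (G.minDegree : ℝ) < (1 - 1 / r + ε) * (n + 1 : ℕ) := by
    by_contra! hcon
    exact hG (hn hcon)
  obtain ⟨v, hv⟩ := G.exists_minimal_degree_vertex
  have h1 := SimpleGraph.card_edgeFinset_deleteIncidenceSet_le_extremalNumber hG v
  rw [G.card_edgeFinset_deleteIncidenceSet v, Fintype.card_fin, Nat.add_sub_cancel, ← hv] at h1
  have h2 : (G.edgeFinset.card : ℝ) ≤ SimpleGraph.extremalNumber n H + G.minDegree := by
    exact_mod_cast Nat.sub_le_iff_le_add.1 h1
  linarith

/-- Edge version of the Erdős–Stone theorem. -/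
theorem eventually_extremalNumber_completeEquipartiteGraph_le {ε : ℝ} (hε : 0 < ε) (r t : ℕ) :
    ∀ᶠ n : ℕ in atTop,
      (SimpleGraph.extremalNumber n (SimpleGraph.completeEquipartiteGraph (r + 1) t) : ℝ) ≤
        ((1 / 2 : ℝ) * (1 - 1 / r) + ε) * (n : ℝ) ^ 2 := by
  obtain ⟨M, hM⟩ := eventually_atTop.1 (extremalNumber_completeEquipartiteGraph_succ_le hε r t)
  set x : ℕ → ℝ := fun n =>
    SimpleGraph.extremalNumber n (SimpleGraph.completeEquipartiteGraph (r + 1) t)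
  set c : ℝ := 1 - 1 / r
  have hc : (0 : ℝ) ≤ c := by
    rcases Nat.eq_zero_or_pos r with rfl | hr
    · simp [c]
    · have : (1 : ℝ) / r ≤ 1 := by
        rw [div_le_one (by positivity)]; exact_mod_cast hr
      simp only [c]; linarith
  have hx : ∀ n, M ≤ n → x n ≤ x M + (c + ε) * (n * (n + 1) / 2) := by
    intro n hn
    induction n, hn using Nat.le_induction with
    | base => nlinarith [show 0 ≤ (c + ε) * ((M : ℝ) * (M + 1) / 2) by positivity]
    | succ n hn ih =>
      have h1 : x (n + 1) ≤ x n + (c + ε) * (n + 1 : ℕ) := hM n hn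
      push_cast at h1 ⊢
      nlinarith
  have hM0 : 0 ≤ x M := Nat.cast_nonneg _
  -- The threshold makes `ε * n ^ 2 / 2` absorb the starting value `x M` and the linear term `(c +
  -- ε) * n / 2`.
  filter_upwards [eventually_ge_atTop (M + 1 + ⌈(2 * x M + c + ε) / ε⌉₊)] with n hn
  have hn1 : (1 : ℝ) ≤ n := by exact_mod_cast (by omega : 1 ≤ n)
  have h1 : (2 * x M + c + ε) / ε ≤ n :=
    (Nat.le_ceil _).trans (Nat.cast_le.2 (by omega))
  rw [div_le_iff₀ hε] at h1
  have h2 : x n ≤ x M + (c + ε) * (n * (n + 1) / 2) := hx n (by omega)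
  have h3 : x M ≤ x M * n := by nlinarith
  have h4 : (2 * x M + c + ε) * n ≤ n * ε * n := by gcongr
  change x n ≤ ((1 / 2 : ℝ) * c + ε) * (n : ℝ) ^ 2
  nlinarith

/-! ### The Turán graph -/

theorem tendsto_card_edgeFinset_turanGraph_div_sq {r : ℕ} (hr : 1 ≤ r) :
    Tendsto (fun n : ℕ => ((SimpleGraph.turanGraph n r).edgeFinset.card : ℝ) / (n : ℝ) ^ 2) atTop
      (𝓝 ((1 / 2 : ℝ) * (1 - 1 / (r : ℝ)))) := by
  have hr0 : (0 : ℝ) < r := by exact_mod_cast hr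
  have hinv : Tendsto (fun n : ℕ => ((r : ℝ) ^ 2 + 1) * ((n : ℝ)⁻¹) ^ 2) atTop (𝓝 0) := by
    simpa using (tendsto_inv_atTop_nhds_zero_nat (𝕜 := ℝ)).pow 2 |>.const_mul ((r : ℝ) ^ 2 + 1)
  -- The error `(r ^ 2 + 1) / n ^ 2` pays for the remainder `n % r` and for rounding down in the
  -- Turán count.
  have hlow : Tendsto (fun n : ℕ => (1 / 2 : ℝ) * (1 - 1 / (r : ℝ)) -
      ((r : ℝ) ^ 2 + 1) * ((n : ℝ)⁻¹) ^ 2) atTop (𝓝 ((1 / 2 : ℝ) * (1 - 1 / (r : ℝ)))) := by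
    simpa using tendsto_const_nhds.sub hinv
  refine tendsto_of_tendsto_of_tendsto_of_le_of_le' hlow tendsto_const_nhds ?_ ?_
  · filter_upwards [eventually_ge_atTop r] with n hn
    have hn0 : (0 : ℝ) < n := by exact_mod_cast (by omega : 0 < n)
    rw [le_div_iff₀ (by positivity), sub_mul, mul_assoc (_ + _), ← mul_pow,
      inv_mul_cancel₀ hn0.ne', one_pow, mul_one]
    have hle : (n ^ 2 - (n % r) ^ 2) * (r - 1) / (2 * r) ≤
        (SimpleGraph.turanGraph n r).edgeFinset.card := by
      rw [SimpleGraph.card_edgeFinset_turanGraph]; exact Nat.le_add_right _ _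
    have hlt := Nat.lt_div_mul_add (a := (n ^ 2 - (n % r) ^ 2) * (r - 1)) (b := 2 * r) (by omega)
    set e := (SimpleGraph.turanGraph n r).edgeFinset.card
    have h1 : (n ^ 2 - (n % r) ^ 2) * (r - 1) ≤ e * (2 * r) + 2 * r :=
      hlt.le.trans (by gcongr)
    have hmod : (n % r) ^ 2 ≤ n ^ 2 := Nat.pow_le_pow_left (Nat.mod_le _ _) 2
    have h2 : ((n : ℝ) ^ 2 - ((n % r : ℕ) : ℝ) ^ 2) * (r - 1) ≤ e * (2 * r) + 2 * r := by
      have := (Nat.cast_le (α := ℝ)).2 h1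
      push_cast [Nat.cast_sub hmod, Nat.cast_sub hr] at this
      simpa using this
    have h3 : ((n % r : ℕ) : ℝ) ^ 2 ≤ (r : ℝ) ^ 2 := by
      gcongr; exact (Nat.mod_lt _ hr).le
    have hr1 : (0 : ℝ) ≤ r - 1 := by
      have : (1 : ℝ) ≤ r := by exact_mod_cast hr
      linarith
    have h4 : ((n : ℝ) ^ 2 - (r : ℝ) ^ 2) * (r - 1) ≤ e * (2 * r) + 2 * r :=
      le_trans (by gcongr) h2
    have h5 : (1 / 2 : ℝ) * (1 - 1 / (r : ℝ)) * (n : ℝ) ^ 2 =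
        ((n : ℝ) ^ 2 * (r - 1)) / (2 * r) := by field_simp
    rw [h5, sub_le_iff_le_add, div_le_iff₀ (by positivity)]
    nlinarith [mul_pos (mul_pos hr0 hr0) hr0, sq_nonneg (r : ℝ)]
  · filter_upwards [eventually_ge_atTop 1] with n hn
    have hn0 : (0 : ℝ) < n := by exact_mod_cast hn
    rw [div_le_iff₀ (by positivity)]
    have h := (Nat.cast_le (α := ℝ)).2 (SimpleGraph.mul_card_edgeFinset_turanGraph_le (n := n) (r := r))
    push_cast [Nat.cast_sub hr] at h
    have h5 : (1 / 2 : ℝ) * (1 - 1 / (r : ℝ)) * (n : ℝ) ^ 2 =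
        ((r - 1) * (n : ℝ) ^ 2) / (2 * r) := by field_simp
    rw [h5, le_div_iff₀ (by positivity)]
    linarith

theorem tendsto_div_sq_of_le {T f u : ℕ → ℕ} {L : ℝ}
    (hT : Tendsto (fun n : ℕ => (T n : ℝ) / (n : ℝ) ^ 2) atTop (𝓝 L))
    (hu : ∀ ε : ℝ, 0 < ε → ∀ᶠ n : ℕ in atTop, (u n : ℝ) ≤ (L + ε) * (n : ℝ) ^ 2)
    (hTf : ∀ n, T n ≤ f n) (hfu : ∀ n, f n ≤ u n) :
    Tendsto (fun n : ℕ => (f n : ℝ) / (n : ℝ) ^ 2) atTop (𝓝 L) := by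
  refine tendsto_order.2 ⟨fun b hb => ?_, fun b hb => ?_⟩
  · filter_upwards [(tendsto_order.1 hT).1 b hb] with n hn
    refine hn.trans_le ?_
    gcongr
    exact hTf n
  · filter_upwards [hu ((b - L) / 2) (by linarith), eventually_ge_atTop 1] with n hn hn1
    have hn0 : (0 : ℝ) < n := by exact_mod_cast hn1
    rw [div_lt_iff₀ (by positivity)]
    have h1 : (f n : ℝ) ≤ u n := by exact_mod_cast hfu n
    have h2 : (0 : ℝ) < (n : ℝ) ^ 2 := by positivity
    nlinarith

/-! ### Finite-dimensional norms -/

section General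

variable {E : Type*} [AddCommGroup E] [Module ℝ E]

/-- Hahn–Banach, with `N` installed as the seminorm of the space. -/
theorem Seminorm.exists_linearMap_le (N : Seminorm ℝ E) (x : E) :
    ∃ φ : E →ₗ[ℝ] ℝ, φ x = N x ∧ ∀ y, φ y ≤ N y := by
  let : SeminormedAddCommGroup E := N.toAddGroupSeminorm.toSeminormedAddCommGroup
  let : NormedSpace ℝ E := ⟨fun a b => (map_smul_eq_mul N a b).le⟩
  obtain ⟨g, hg, hgx⟩ := exists_dual_vector'' ℝ x
  refine ⟨g.toLinearMap, hgx, fun y => ?_⟩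
  have h := g.le_of_opNorm_le hg y
  rw [one_mul] at h
  exact (Real.le_norm_self _).trans h

theorem Seminorm.card_le_of_separated [FiniteDimensional ℝ E] (N : Seminorm ℝ E)
    (hN : ∀ x, N x = 0 → x = 0) (s : Finset E) (hs : ∀ c ∈ s, N c ≤ 2)
    (h : ∀ c ∈ s, ∀ d ∈ s, c ≠ d → 1 ≤ N (c - d)) :
    s.card ≤ 5 ^ Module.finrank ℝ E := by
  let : NormedAddCommGroup E := AddGroupNorm.toNormedAddCommGroup
    { N.toAddGroupSeminorm with eq_zero_of_map_eq_zero' := hN }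
  let : NormedSpace ℝ E := ⟨fun a b => (map_smul_eq_mul N a b).le⟩
  exact Besicovitch.card_le_of_separated s hs h

/-- A large subset of a unit ball contains a subset of given cardinality and of diameter less
than one. -/
theorem Seminorm.exists_subset_card_lt_one [FiniteDimensional ℝ E] (N : Seminorm ℝ E)
    (hN : ∀ x, N x = 0 → x = 0) (Q : Finset E) (z : E) (hQ : ∀ x ∈ Q, N (x - z) ≤ 1) (m : ℕ)
    (hm : 5 ^ Module.finrank ℝ E * m < Q.card) :
    ∃ S ⊆ Q, m ≤ S.card ∧ ∀ x ∈ S, ∀ y ∈ S, N (x - y) < 1 := by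
  classical
  let good : Finset (Finset E) := Q.powerset.filter fun S =>
    ∀ x ∈ S, ∀ y ∈ S, x ≠ y → 1 / 2 ≤ N (x - y)
  obtain ⟨S, hS⟩ := good.exists_maximal ⟨∅, by simp [good]⟩
  have hSg := hS.prop
  simp only [good, Finset.mem_filter, Finset.mem_powerset] at hSg
  have hcard : S.card ≤ 5 ^ Module.finrank ℝ E := by
    -- Doubling about `z` turns a `1/2`-separated set in the unit ball into a `1`-separated set in
    -- the ball of radius 2, as the packing bound requires.
    have hinj : Function.Injective fun x : E => (2 : ℝ) • (x - z) := fun x y hxy => by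
      have := smul_right_injective E (two_ne_zero (α := ℝ)) hxy
      exact sub_left_injective this
    rw [← Finset.card_image_of_injective S hinj]
    refine N.card_le_of_separated hN _ ?_ ?_
    · simp only [Finset.mem_image, forall_exists_index, and_imp, forall_apply_eq_imp_iff₂]
      intro x hx
      rw [map_smul_eq_mul, Real.norm_ofNat]
      linarith [hQ x (hSg.1 hx)]
    · simp only [Finset.mem_image, forall_exists_index, and_imp, forall_apply_eq_imp_iff₂]
      intro x hx y hy hxy
      rw [← smul_sub, sub_sub_sub_cancel_right, map_smul_eq_mul, Real.norm_ofNat]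
      linarith [hSg.2 x hx y hy (fun h => hxy (by rw [h]))]
  -- By maximality the open balls of radius `1/2` about `S` cover `Q`; pigeonhole then puts more
  -- than `m` points in one of them.
  have hcover : ∀ x ∈ Q, ∃ s ∈ S, N (x - s) < 1 / 2 := by
    intro x hx
    by_contra! hcon
    have hmem : insert x S ∈ good := by
      simp only [good, Finset.mem_filter, Finset.mem_powerset]
      refine ⟨Finset.insert_subset hx hSg.1, ?_⟩
      intro a ha b hb hab
      rcases Finset.mem_insert.1 ha with rfl | ha'
      · rcases Finset.mem_insert.1 hb with rfl | hb
        · exact absurd rfl hab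
        · exact hcon b hb
      · rcases Finset.mem_insert.1 hb with rfl | hb
        · rw [map_sub_rev]; exact hcon a ha'
        · exact hSg.2 a ha' b hb hab
    have hxS : x ∈ S := hS.le_of_ge hmem (Finset.subset_insert x S) (Finset.mem_insert_self x S)
    have := hcon x hxS
    simp at this
    linarith
  choose! g hgS hg using hcover
  obtain ⟨s, -, hs⟩ := Finset.exists_lt_card_fiber_of_mul_lt_card_of_maps_to (n := m) hgS
    (lt_of_le_of_lt (Nat.mul_le_mul_right m hcard) hm)
  refine ⟨_, Finset.filter_subset _ _, hs.le, fun x hx y hy => ?_⟩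
  rw [Finset.mem_filter] at hx hy
  have h1 := hg x hx.1
  have h2 := hg y hy.1
  rw [hx.2] at h1
  rw [hy.2] at h2
  have h3 := map_sub_le_add N (x - s) (y - s)
  rw [sub_sub_sub_cancel_right] at h3
  linarith

end General

/-! ### Strictly convex norms -/

theorem IsStrictlyConvexNorm.map_add_lt {d : ℕ} {N : Seminorm ℝ (Rd d)}
    (hN : IsStrictlyConvexNorm N) {x y : Rd d} (hx : N x ≤ 1) (hy : N y ≤ 1) (hxy : x ≠ y) :
    N (x + y) < 2 := by
  by_cases h : N x = 1 ∧ N y = 1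
  · exact hN.map_add_lt_two x y h.1 h.2 hxy
  · have h1 := map_add_le_add N x y
    rcases hx.lt_or_eq with h2 | h2
    · linarith
    · rcases hy.lt_or_eq with h3 | h3
      · linarith
      · exact absurd ⟨h2, h3⟩ h

theorem IsStrictlyConvexNorm.sup {d : ℕ} {N M : Seminorm ℝ (Rd d)}
    (hN : IsStrictlyConvexNorm N) (hM : IsStrictlyConvexNorm M) :
    IsStrictlyConvexNorm (N ⊔ M) where
  eq_zero_of_map_eq_zero := fun x hx => hN.eq_zero_of_map_eq_zero x
    (le_antisymm ((le_sup_left : N x ≤ N x ⊔ M x).trans_eq hx) (apply_nonneg N x))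
  map_add_lt_two := fun x y hx hy hxy => by
    rw [Seminorm.sup_apply] at hx hy ⊢
    exact max_lt
      (hN.map_add_lt ((le_max_left _ _).trans_eq hx) ((le_max_left _ _).trans_eq hy) hxy)
      (hM.map_add_lt ((le_max_right _ _).trans_eq hx) ((le_max_right _ _).trans_eq hy) hxy)

theorem isStrictlyConvexNorm_comp {d : ℕ} {F : Type*} [NormedAddCommGroup F]
    [InnerProductSpace ℝ F] (T : Rd d →ₗ[ℝ] F) (hT : Function.Injective T) :
    IsStrictlyConvexNorm ((normSeminorm ℝ F).comp T) where
  eq_zero_of_map_eq_zero := fun x hx =>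
    (map_eq_zero_iff T hT).1 (norm_eq_zero.mp hx)
  map_add_lt_two := fun x y hx hy hxy => by
    have hx' : ‖T x‖ = 1 := hx
    have hy' : ‖T y‖ = 1 := hy
    change ‖T (x + y)‖ < 2
    rw [map_add]
    have h := parallelogram_law_with_norm ℝ (T x) (T y)
    have h0 : 0 < ‖T x - T y‖ := norm_pos_iff.mpr (sub_ne_zero.mpr (hT.ne hxy))
    rw [hx', hy'] at h
    nlinarith [norm_nonneg (T x + T y)]

theorem IsStrictlyConvexNorm.comp_smul {d : ℕ} {N : Seminorm ℝ (Rd d)}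
    (hN : IsStrictlyConvexNorm N) {c : ℝ} (hc : c ≠ 0) :
    IsStrictlyConvexNorm (N.comp (c • LinearMap.id)) where
  eq_zero_of_map_eq_zero := fun x hx =>
    (smul_eq_zero.1 (hN.eq_zero_of_map_eq_zero (c • x) hx)).resolve_left hc
  map_add_lt_two := fun x y hx hy hxy => by
    change N (c • (x + y)) < 2
    rw [smul_add]
    exact hN.map_add_lt_two (c • x) (c • y) hx hy fun h => hxy (smul_right_injective _ hc h)

theorem exists_pos_smul_lt_one {α : Type*} (V : Finset α) (f : α → ℝ) (hf : ∀ v ∈ V, 0 ≤ f v) :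
    ∃ c : ℝ, 0 < c ∧ ∀ v ∈ V, c * f v < 1 := by
  refine ⟨1 / (∑ v ∈ V, f v + 1), by have := Finset.sum_nonneg hf; positivity, fun v hv => ?_⟩
  have h0 := Finset.sum_nonneg hf
  have h1 := Finset.single_le_sum hf hv
  rw [div_mul_eq_mul_div, one_mul, div_lt_one (by positivity)]
  linarith

/-- A vector strictly supported by a functional among a finite set of vectors is the unique point,
up to sign, of norm at least one for a suitable strictly convex norm. -/
theorem exists_isStrictlyConvexNorm_of_functional {d : ℕ} (V : Finset (Rd d)) (v : Rd d)
    (ψ : Rd d →ₗ[ℝ] ℝ) (hv : ψ v = 1) (hψ : ∀ w ∈ V, w ≠ v → w ≠ -v → |ψ w| < 1) :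
    ∃ N : Seminorm ℝ (Rd d), IsStrictlyConvexNorm N ∧ N v = 1 ∧
      ∀ w ∈ V, w ≠ v → w ≠ -v → N w < 1 := by
  classical
  -- The squared norm will be `ψ x ^ 2 + c * ‖x - ψ x • v‖ ^ 2`. The second term vanishes at `v`,
  -- and `c` is small enough to keep the other vectors of `V` inside the unit ball.
  obtain ⟨c, hc, hcV⟩ := exists_pos_smul_lt_one (V.filter fun w => w ≠ v ∧ w ≠ -v)
    (fun w => ‖w - ψ w • v‖ ^ 2 / (1 - ψ w ^ 2)) (by
      intro w hw
      rw [Finset.mem_filter] at hw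
      have := (sq_lt_one_iff_abs_lt_one _).2 (hψ w hw.1 hw.2.1 hw.2.2)
      have : 0 < 1 - ψ w ^ 2 := by linarith
      positivity)
  let R : Rd d →ₗ[ℝ] Rd d := √c • (LinearMap.id - ψ.smulRight v)
  let T : Rd d →ₗ[ℝ] WithLp 2 (ℝ × Rd d) :=
    (WithLp.linearEquiv 2 ℝ (ℝ × Rd d)).symm.toLinearMap ∘ₗ ψ.prod R
  have hTn : ∀ x, ‖T x‖ ^ 2 = ψ x ^ 2 + c * ‖x - ψ x • v‖ ^ 2 := by
    intro x
    rw [WithLp.prod_norm_sq_eq_of_L2]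
    change ‖ψ x‖ ^ 2 + ‖√c • (x - ψ x • v)‖ ^ 2 = _
    rw [norm_smul, mul_pow, Real.norm_eq_abs, sq_abs, Real.norm_eq_abs, sq_abs, Real.sq_sqrt hc.le]
  have hinj : Function.Injective T := by
    rw [← LinearMap.ker_eq_bot, LinearMap.ker_eq_bot']
    intro x hx
    have h := hTn x
    rw [hx, norm_zero] at h
    have h1 : 0 ≤ c * ‖x - ψ x • v‖ ^ 2 := by positivity
    have h2 : ψ x = 0 := by
      have := sq_nonneg (ψ x)
      exact pow_eq_zero_iff two_ne_zero |>.1 (by linarith)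
    rw [h2, zero_smul, sub_zero] at h
    have h3 : c * ‖x‖ ^ 2 = 0 := by linarith
    simpa [hc.ne'] using h3
  refine ⟨_, isStrictlyConvexNorm_comp T hinj, ?_, ?_⟩
  · change ‖T v‖ = 1
    have h := hTn v
    rw [hv, one_smul, sub_self, norm_zero] at h
    exact (pow_eq_one_iff_of_nonneg (norm_nonneg _) two_ne_zero).1 (by linarith)
  · intro w hw h1 h2
    change ‖T w‖ < 1
    have h := hcV w (Finset.mem_filter.2 ⟨hw, h1, h2⟩)
    have h3 := (sq_lt_one_iff_abs_lt_one _).2 (hψ w hw h1 h2)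
    rw [← mul_div_assoc, div_lt_one (by linarith)] at h
    have h4 := hTn w
    exact (sq_lt_one_iff₀ (norm_nonneg _)).1 (by linarith)

/-- Take the supremum of one ellipsoidal norm per `v ∈ S`: each is at most 1 on `V`, so none spoils
the value 1 attained by another. -/
theorem exists_isStrictlyConvexNorm_of_functionals {d : ℕ} (V S : Finset (Rd d)) (hSV : S ⊆ V)
    (hS : ∀ v ∈ S, ∃ ψ : Rd d →ₗ[ℝ] ℝ, ψ v = 1 ∧ ∀ w ∈ V, w ≠ v → w ≠ -v → |ψ w| < 1) :
    ∃ N : Seminorm ℝ (Rd d), IsStrictlyConvexNorm N ∧ (∀ v ∈ S, N v = 1) ∧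
      ∀ w ∈ V, (∀ v ∈ S, w ≠ v ∧ w ≠ -v) → N w < 1 := by
  classical
  induction S using Finset.induction with
  | empty =>
    obtain ⟨c, hc, hcV⟩ := exists_pos_smul_lt_one V (fun v => ‖v‖) (fun v _ => norm_nonneg v)
    refine ⟨_, (isStrictlyConvexNorm_normSeminorm d).comp_smul hc.ne', by simp, fun w hw _ => ?_⟩
    change ‖c • w‖ < 1
    rw [norm_smul, Real.norm_of_nonneg hc.le]
    exact hcV w hw
  | insert e S he ih =>
    obtain ⟨N, hN, hN1, hN2⟩ := ih ((Finset.subset_insert e S).trans hSV)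
      (fun v hv => hS v (Finset.mem_insert_of_mem hv))
    obtain ⟨ψ, hψ, hψV⟩ := hS e (Finset.mem_insert_self e S)
    obtain ⟨M, hM, hM1, hM2⟩ := exists_isStrictlyConvexNorm_of_functional V e ψ hψ hψV
    have hNle : ∀ w ∈ V, N w ≤ 1 := by
      intro w hw
      by_cases h : ∀ v ∈ S, w ≠ v ∧ w ≠ -v
      · exact (hN2 w hw h).le
      · push Not at h
        obtain ⟨v, hv, h⟩ := h
        by_cases hwv : w = v
        · rw [hwv, hN1 v hv]
        · rw [h hwv, map_neg_eq_map, hN1 v hv]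
    have hMle : ∀ w ∈ V, M w ≤ 1 := by
      intro w hw
      by_cases h1 : w = e
      · rw [h1, hM1]
      · by_cases h2 : w = -e
        · rw [h2, map_neg_eq_map, hM1]
        · exact (hM2 w hw h1 h2).le
    refine ⟨N ⊔ M, hN.sup hM, ?_, ?_⟩
    · intro v hv
      rw [Seminorm.sup_apply]
      rcases Finset.mem_insert.1 hv with rfl | hvS
      · rw [hM1]
        exact max_eq_right (hNle v (hSV hv))
      · rw [hN1 v hvS]
        exact max_eq_left (hMle v (hSV hv))
    · intro w hw h
      rw [Seminorm.sup_apply]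
      exact max_lt (hN2 w hw fun v hv => h v (Finset.mem_insert_of_mem hv))
        (hM2 w hw (h e (Finset.mem_insert_self e S)).1 (h e (Finset.mem_insert_self e S)).2)

/-! ### Strictly antipodal families -/

/-- Divide the separating functional by its gap `φ q - φ p`: its values on the union lie between
those at `p` and `q`, and only these two points attain the extremes. -/
theorem StrictlyAntipodal.exists_functional {d : ℕ} {ι : Type*} {A : ι → Set (Rd d)}
    (hA : StrictlyAntipodal A) (hcard : ∀ i, (3 : ℕ∞) ≤ (A i).encard) {i j : ι} (hij : i ≠ j)
    {p q : Rd d} (hp : p ∈ A i) (hq : q ∈ A j) :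
    ∃ ψ : Rd d →ₗ[ℝ] ℝ, ψ (q - p) = 1 ∧
      ∀ x ∈ ⋃ l, A l, ∀ y ∈ ⋃ l, A l, s(x, y) ≠ s(p, q) → |ψ (x - y)| < 1 := by
  obtain ⟨φ, hφ⟩ := hA i j hij p hp q hq
  have hpq : φ p < φ q := by
    -- Without a third point strict antipodality says nothing about `φ p < φ q`, hence the lower
    -- bound 3 on the sizes.
    obtain ⟨r, hr, hrn⟩ : ∃ r ∈ A i, r ∉ ({p, q} : Set (Rd d)) := by
      by_contra! hcon
      have h1 := (hcard i).trans (Set.encard_le_encard (t := {p, q}) hcon)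
      have h2 := h1.trans (Set.encard_insert_le {q} p)
      rw [Set.encard_singleton] at h2
      exact absurd h2 (by decide)
    have := hφ r ⟨Set.mem_iUnion.2 ⟨i, hr⟩, hrn⟩
    exact this.1.trans this.2
  have hcase : ∀ x ∈ ⋃ l, A l, x = p ∨ x = q ∨ (φ p < φ x ∧ φ x < φ q) := by
    intro x hx
    by_cases h1 : x = p
    · exact Or.inl h1
    · by_cases h2 : x = q
      · exact Or.inr (Or.inl h2)
      · exact Or.inr (Or.inr (hφ x ⟨hx, by simp [h1, h2]⟩))
  have hpos : 0 < φ q - φ p := sub_pos.2 hpq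
  refine ⟨(φ q - φ p)⁻¹ • φ, ?_, fun x hx y hy hxy => ?_⟩
  · rw [LinearMap.smul_apply, map_sub, smul_eq_mul, inv_mul_cancel₀ hpos.ne']
  · rw [LinearMap.smul_apply, map_sub, smul_eq_mul, abs_mul, abs_of_pos (inv_pos.2 hpos),
      inv_mul_lt_iff₀ hpos, mul_one, abs_lt]
    rcases hcase x hx with rfl | rfl | hx' <;> rcases hcase y hy with rfl | rfl | hy'
    · constructor <;> linarith
    · exact absurd rfl hxy
    · constructor <;> linarith
    · exact absurd Sym2.eq_swap hxy
    · constructor <;> linarith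
    · constructor <;> linarith
    · constructor <;> linarith
    · constructor <;> linarith
    · constructor <;> linarith

theorem StrictlyAntipodal.ne {d : ℕ} {ι : Type*} {A : ι → Set (Rd d)}
    (hA : StrictlyAntipodal A) (hcard : ∀ i, (3 : ℕ∞) ≤ (A i).encard) {i j : ι} (hij : i ≠ j)
    {p q : Rd d} (hp : p ∈ A i) (hq : q ∈ A j) : p ≠ q := by
  rintro rfl
  obtain ⟨ψ, hψ, -⟩ := hA.exists_functional hcard hij hp hq
  simp at hψ

/-- Segments between different members of a strictly antipodal family are never parallel. -/
theorem StrictlyAntipodal.eq_of_pairDirection_eq {d : ℕ} {ι : Type*} {A : ι → Set (Rd d)}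
    (hA : StrictlyAntipodal A) (hcard : ∀ i, (3 : ℕ∞) ≤ (A i).encard) {i j i' j' : ι}
    (hij : i ≠ j) (hij' : i' ≠ j') {p q x y : Rd d} (hp : p ∈ A i) (hq : q ∈ A j)
    (hx : x ∈ A i') (hy : y ∈ A j') (h : pairDirection s(p, q) = pairDirection s(x, y)) :
    s(p, q) = s(x, y) := by
  by_contra hne
  obtain ⟨ψ, hψ, hψ'⟩ := hA.exists_functional hcard hij hp hq
  obtain ⟨χ, hχ, hχ'⟩ := hA.exists_functional hcard hij' hx hy
  have h1 := hψ' x (Set.mem_iUnion.2 ⟨_, hx⟩) y (Set.mem_iUnion.2 ⟨_, hy⟩) (Ne.symm hne)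
  have h2 := hχ' p (Set.mem_iUnion.2 ⟨_, hp⟩) q (Set.mem_iUnion.2 ⟨_, hq⟩) hne
  change Submodule.span ℝ {p - q} = Submodule.span ℝ {x - y} at h
  have hmem : p - q ∈ Submodule.span ℝ {x - y} := h ▸ Submodule.mem_span_singleton_self _
  -- If `p - q = c • (x - y)`, then `ψ` forces `|c| > 1` while `χ` forces `|c| < 1`.
  obtain ⟨c, hc⟩ := Submodule.mem_span_singleton.1 hmem
  have hψpq : |ψ (p - q)| = 1 := by rw [← neg_sub, map_neg, abs_neg, hψ, abs_one]
  have hχxy : |χ (x - y)| = 1 := by rw [← neg_sub, map_neg, abs_neg, hχ, abs_one]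
  rw [← hc, map_smul, smul_eq_mul, abs_mul] at hψpq h2
  rw [hχxy, mul_one] at h2
  nlinarith [abs_nonneg c, abs_nonneg (ψ (x - y))]

theorem StrictlyAntipodal.exists_norm {d : ℕ} {ι : Type*} {A : ι → Set (Rd d)}
    (hA : StrictlyAntipodal A) (hcard : ∀ i, (3 : ℕ∞) ≤ (A i).encard) (P : Finset (Rd d))
    (hP : ↑P ⊆ ⋃ i, A i) :
    ∃ N : Seminorm ℝ (Rd d), IsStrictlyConvexNorm N ∧
      (∀ i j, i ≠ j → ∀ p ∈ A i, ∀ q ∈ A j, p ∈ P → q ∈ P → N (p - q) = 1) ∧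
      ∀ p ∈ P, ∀ q ∈ P, N (p - q) ≤ 1 := by
  classical
  let V : Finset (Rd d) := (P ×ˢ P).image fun z => z.1 - z.2
  let S : Finset (Rd d) := V.filter fun v => ∃ i j, i ≠ j ∧ ∃ p ∈ A i, ∃ q ∈ A j, v = q - p
  have hV : ∀ p ∈ P, ∀ q ∈ P, p - q ∈ V := fun p hp q hq =>
    Finset.mem_image.2 ⟨(p, q), Finset.mk_mem_product hp hq, rfl⟩
  obtain ⟨N, hN, hN1, hN2⟩ := exists_isStrictlyConvexNorm_of_functionals V S
    (Finset.filter_subset _ _) (by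
      intro v hv
      obtain ⟨-, i, j, hij, p, hp, q, hq, rfl⟩ := Finset.mem_filter.1 hv
      obtain ⟨ψ, hψ, hψ'⟩ := hA.exists_functional hcard hij hp hq
      refine ⟨ψ, hψ, fun w hw h1 h2 => ?_⟩
      obtain ⟨⟨x, y⟩, hxy, rfl⟩ := Finset.mem_image.1 hw
      rw [Finset.mem_product] at hxy
      refine hψ' x (hP hxy.1) y (hP hxy.2) fun h => ?_
      rcases Sym2.eq_iff.1 h with ⟨rfl, rfl⟩ | ⟨rfl, rfl⟩
      · exact h2 (neg_sub _ _).symm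
      · exact h1 rfl)
  refine ⟨N, hN, fun i j hij p hp q hq hpP hqP => ?_, fun p hp q hq => ?_⟩
  · exact hN1 _ (Finset.mem_filter.2 ⟨hV p hpP q hqP, j, i, hij.symm, q, hq, p, hp, rfl⟩)
  · by_cases h : ∀ v ∈ S, p - q ≠ v ∧ p - q ≠ -v
    · exact (hN2 _ (hV p hp q hq) h).le
    · push Not at h
      obtain ⟨v, hv, h⟩ := h
      by_cases hpv : p - q = v
      · rw [hpv, hN1 v hv]
      · rw [h hpv, map_neg_eq_map, hN1 v hv]

/-- One point from each set gives points at mutual distance 1 in some norm, and packing bounds their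
number. This makes the supremum defining `antipodalNumber` a maximum. -/
theorem le_of_mem_antipodalSizes {d k : ℕ} (hk : k ∈ antipodalSizes d) : k ≤ 5 ^ d := by
  classical
  obtain ⟨A, hA, hcard⟩ := hk 3
  have hcard' : ∀ i, (3 : ℕ∞) ≤ (A i).encard := hcard
  rcases Nat.eq_zero_or_pos k with rfl | hk0
  · exact Nat.zero_le _
  have hne : ∀ i, ∃ p, p ∈ A i := fun i => by
    refine Set.nonempty_iff_ne_empty.2 fun h => ?_
    have := hcard' i
    rw [h, Set.encard_empty] at this
    exact absurd this (by decide)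
  choose p hp using hne
  obtain ⟨N, hN, hN1, hN2⟩ := hA.exists_norm hcard' (Finset.univ.image p) (by
    intro x hx
    obtain ⟨i, -, rfl⟩ := Finset.mem_image.1 (Finset.mem_coe.1 hx)
    exact Set.mem_iUnion.2 ⟨i, hp i⟩)
  have hmem : ∀ i, p i ∈ Finset.univ.image p := fun i =>
    Finset.mem_image_of_mem p (Finset.mem_univ i)
  have hinj : Function.Injective p := fun i j hij => by
    by_contra h
    exact hA.ne hcard' h (hp i) (hp j) hij
  have h := N.card_le_of_separated hN.eq_zero_of_map_eq_zero
    (Finset.univ.image fun i => p i - p ⟨0, hk0⟩) (by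
      simp only [Finset.mem_image, Finset.mem_univ, true_and, forall_exists_index,
        forall_apply_eq_imp_iff]
      intro i
      linarith [hN2 _ (hmem i) _ (hmem ⟨0, hk0⟩)]) (by
      simp only [Finset.mem_image, Finset.mem_univ, true_and, forall_exists_index,
        forall_apply_eq_imp_iff]
      intro i j hij
      rw [sub_sub_sub_cancel_right]
      exact (hN1 i j (fun h => hij (by rw [h])) _ (hp i) _ (hp j) (hmem i) (hmem j)).ge)
  rw [Finset.card_image_of_injective _ fun i j hij => hinj (sub_left_injective hij)] at h
  simpa using h

theorem one_mem_antipodalSizes {d : ℕ} (hd : 1 ≤ d) : 1 ∈ antipodalSizes d := by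
  have : Nonempty (Fin d) := ⟨⟨0, hd⟩⟩
  refine fun m => ⟨fun _ => Set.univ, fun i j hij => absurd (Subsingleton.elim i j) hij, fun i => ?_⟩
  rw [Set.encard_univ, ENat.card_eq_top_of_infinite]
  exact le_top

theorem isGreatest_antipodalNumber {d : ℕ} (hd : 1 ≤ d) :
    IsGreatest (antipodalSizes d) (antipodalNumber d) :=
  have hb : BddAbove (antipodalSizes d) := ⟨5 ^ d, fun _ hk => le_of_mem_antipodalSizes hk⟩
  ⟨Nat.sSup_mem ⟨1, one_mem_antipodalSizes hd⟩ hb, fun _ hk => le_csSup hb hk⟩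

/-! ### Lower bounds -/

/-- The Turán graph is realized by the cross pairs of a strictly antipodal family, at unit distance
and in pairwise different directions. -/
theorem exists_turanGraph_configuration {d k : ℕ} (hk0 : 1 ≤ k) (hk : k ∈ antipodalSizes d)
    (n : ℕ) :
    ∃ N : Seminorm ℝ (Rd d), IsStrictlyConvexNorm N ∧ ∃ P : Finset (Rd d), P.card = n ∧
      (∀ p ∈ P, ∀ q ∈ P, N (p - q) ≤ 1) ∧
      ∃ F : Finset (Sym2 (Rd d)), F ⊆ unitPairs N P ∧
        (F : Set (Sym2 (Rd d))).Pairwise (fun e f => pairDirection e ≠ pairDirection f) ∧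
        F.card = (SimpleGraph.turanGraph n k).edgeFinset.card := by
  classical
  obtain ⟨A, hA, hcard⟩ := hk (n + 3)
  have hcard3 : ∀ i, (3 : ℕ∞) ≤ (A i).encard := fun i =>
    le_trans (by exact_mod_cast Nat.le_add_left 3 n) (hcard i)
  have hg : ∀ i, ∃ g : Fin n → Rd d, Function.Injective g ∧ ∀ x, g x ∈ A i := by
    intro i
    obtain ⟨t, ht, htn⟩ := Set.exists_subset_encard_eq (s := A i) (k := (n : ℕ∞))
      (le_trans (by exact_mod_cast Nat.le_add_right n 3) (hcard i))
    have hfin : t.Finite := Set.finite_of_encard_eq_coe htn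
    have hc : hfin.toFinset.card = n := by
      rw [hfin.encard_eq_coe_toFinset_card] at htn
      exact_mod_cast htn
    let e := hfin.toFinset.equivFinOfCardEq hc
    exact ⟨fun x => e.symm x, Subtype.val_injective.comp e.symm.injective,
      fun x => ht (hfin.mem_toFinset.1 (e.symm x).2)⟩
  choose g hginj hgA using hg
  -- Residues modulo `k` are the colour classes of `turanGraph n k`.
  let c : Fin n → Fin k := fun x => ⟨x % k, Nat.mod_lt _ hk0⟩
  let f : Fin n → Rd d := fun x => g (c x) x
  have hfA : ∀ x, f x ∈ A (c x) := fun x => hgA _ _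
  have hf : Function.Injective f := by
    intro x y hxy
    by_cases h : c x = c y
    · have : g (c x) x = g (c x) y := by
        rw [show g (c x) x = g (c y) y from hxy, h]
      exact hginj _ this
    · exact absurd hxy (hA.ne hcard3 h (hfA x) (hfA y))
  obtain ⟨N, hN, hN1, hN2⟩ := hA.exists_norm hcard3 (Finset.univ.image f) (by
    intro x hx
    obtain ⟨i, -, rfl⟩ := Finset.mem_image.1 (Finset.mem_coe.1 hx)
    exact Set.mem_iUnion.2 ⟨c i, hfA i⟩)
  have hmem : ∀ i, f i ∈ Finset.univ.image f := fun i =>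
    Finset.mem_image_of_mem f (Finset.mem_univ i)
  have hadj : ∀ x y, (SimpleGraph.turanGraph n k).Adj x y → c x ≠ c y := fun x y h h' =>
    h (Fin.mk.inj_iff.1 h')
  refine ⟨N, hN, Finset.univ.image f, ?_, hN2,
    (SimpleGraph.turanGraph n k).edgeFinset.map ⟨Sym2.map f, Sym2.map.injective hf⟩, ?_, ?_, ?_⟩
  · rw [Finset.card_image_of_injective _ hf, Finset.card_univ, Fintype.card_fin]
  · intro e he
    obtain ⟨z, hz, rfl⟩ := Finset.mem_map.1 he
    induction z using Sym2.ind with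
    | _ x y =>
      rw [SimpleGraph.mem_edgeFinset, SimpleGraph.mem_edgeSet] at hz
      refine Finset.mem_filter.2 ⟨Finset.mk_mem_sym2_iff.2 ⟨hmem x, hmem y⟩, ?_⟩
      exact hN1 _ _ (hadj x y hz) _ (hfA x) _ (hfA y) (hmem x) (hmem y)
  · intro e he e' he' hne
    obtain ⟨z, hz, rfl⟩ := Finset.mem_map.1 (Finset.mem_coe.1 he)
    obtain ⟨z', hz', rfl⟩ := Finset.mem_map.1 (Finset.mem_coe.1 he')
    induction z using Sym2.ind with
    | _ x y =>
      induction z' using Sym2.ind with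
      | _ x' y' =>
        rw [SimpleGraph.mem_edgeFinset, SimpleGraph.mem_edgeSet] at hz hz'
        exact fun h => hne (hA.eq_of_pairDirection_eq hcard3 (hadj x y hz) (hadj x' y' hz')
          (hfA x) (hfA y) (hfA x') (hfA y') h)
  · rw [Finset.card_map]

theorem card_edgeFinset_turanGraph_le_maxNonparallelUnitPairs {d k : ℕ} (hd : 1 ≤ d) (hk0 : 1 ≤ k)
    (hk : k ∈ antipodalSizes d) (n : ℕ) :
    (SimpleGraph.turanGraph n k).edgeFinset.card ≤ maxNonparallelUnitPairs d n := by
  obtain ⟨N, hN, P, hP, -, F, hF, hFp, hFc⟩ := exists_turanGraph_configuration hk0 hk n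
  exact (isGreatest_maxNonparallelUnitPairs hd n).2 ⟨N, hN, P, hP, F, hF, hFp, hFc⟩

theorem unitPairs_subset_diameterPairs {d : ℕ} {N : Seminorm ℝ (Rd d)} {P : Finset (Rd d)}
    (hP : ∀ p ∈ P, ∀ q ∈ P, N (p - q) ≤ 1) : unitPairs N P ⊆ diameterPairs N P := by
  classical
  intro e he
  obtain ⟨heP, he1⟩ := Finset.mem_filter.1 he
  have hdiam : normDiam N P = 1 := by
    refine IsGreatest.csSup_eq ⟨⟨e, heP, he1⟩, ?_⟩
    rintro _ ⟨z, hz, rfl⟩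
    induction z using Sym2.ind with
    | _ x y =>
      have := Finset.mk_mem_sym2_iff.1 (Finset.mem_coe.1 hz)
      exact hP x this.1 y this.2
  refine Finset.mem_filter.2 ⟨heP, ?_, he1.trans hdiam.symm⟩
  induction e using Sym2.ind with
  | _ x y =>
    intro h
    rw [Sym2.mk_isDiag_iff] at h
    subst h
    change N (x - x) = 1 at he1
    simp at he1

theorem card_edgeFinset_turanGraph_le_maxDiameterPairs {d k : ℕ} (hd : 1 ≤ d) (hk0 : 1 ≤ k)
    (hk : k ∈ antipodalSizes d) (n : ℕ) :
    (SimpleGraph.turanGraph n k).edgeFinset.card ≤ maxDiameterPairs d n := by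
  obtain ⟨N, hN, P, hP, hP1, F, hF, -, hFc⟩ := exists_turanGraph_configuration hk0 hk n
  rw [← hFc]
  exact (Finset.card_le_card (hF.trans (unitPairs_subset_diameterPairs hP1))).trans
    ((isGreatest_maxDiameterPairs hd n).2 ⟨N, hN, P, hP, rfl⟩)

/-! ### Upper bounds -/

theorem maxNonparallelUnitPairs_le_maxUnitPairs {d : ℕ} (hd : 1 ≤ d) (n : ℕ) :
    maxNonparallelUnitPairs d n ≤ maxUnitPairs d n := by
  obtain ⟨N, hN, P, hP, F, hF, -, hFc⟩ := (isGreatest_maxNonparallelUnitPairs hd n).1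
  rw [← hFc]
  exact (Finset.card_le_card hF).trans ((isGreatest_maxUnitPairs hd n).2 ⟨N, hN, P, hP, rfl⟩)

/-- Rescaling the norm by the diameter turns diameter pairs into unit pairs; the diameter is nonzero
as soon as one such pair exists. -/
theorem maxDiameterPairs_le_maxUnitPairs {d : ℕ} (hd : 1 ≤ d) (n : ℕ) :
    maxDiameterPairs d n ≤ maxUnitPairs d n := by
  classical
  obtain ⟨N, hN, P, hP, hc⟩ := (isGreatest_maxDiameterPairs hd n).1
  rw [← hc]
  rcases (diameterPairs N P).eq_empty_or_nonempty with h | ⟨e, he⟩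
  · rw [h, Finset.card_empty]
    exact Nat.zero_le _
  have hδ : normDiam N P ≠ 0 := by
    obtain ⟨-, hdiag, hlen⟩ := Finset.mem_filter.1 he
    rw [← hlen]
    induction e using Sym2.ind with
    | _ x y =>
      intro h0
      exact hdiag (Sym2.mk_isDiag_iff.2 (sub_eq_zero.1 (hN.eq_zero_of_map_eq_zero _ h0)))
  have hδ0 : 0 ≤ normDiam N P := by
    rw [← (Finset.mem_filter.1 he).2.2]
    induction e using Sym2.ind with
    | _ x y => exact apply_nonneg N (x - y)
  refine (Finset.card_le_card ?_).trans ((isGreatest_maxUnitPairs hd n).2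
    ⟨N.comp ((normDiam N P)⁻¹ • LinearMap.id), hN.comp_smul (inv_ne_zero hδ), P, hP, rfl⟩)
  intro z hz
  obtain ⟨hzP, -, hlen⟩ := Finset.mem_filter.1 hz
  refine Finset.mem_filter.2 ⟨hzP, ?_⟩
  induction z using Sym2.ind with
  | _ x y =>
    change N (x - y) = normDiam N P at hlen
    change N ((normDiam N P)⁻¹ • (x - y)) = 1
    rw [map_smul_eq_mul, hlen, norm_inv, Real.norm_of_nonneg hδ0, inv_mul_cancel₀ hδ]

/-- The graph of unit distances among the points of `P`. -/
def unitDistanceGraph {d : ℕ} (N : Seminorm ℝ (Rd d)) (P : Finset (Rd d)) : SimpleGraph P where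
  Adj p q := N (p.1 - q.1) = 1
  symm := ⟨fun p q h => by rw [map_sub_rev]; exact h⟩
  loopless := ⟨fun p h => by simp at h⟩

open Classical in
theorem card_unitPairs_le {d : ℕ} (N : Seminorm ℝ (Rd d)) (P : Finset (Rd d)) :
    (unitPairs N P).card ≤ (unitDistanceGraph N P).edgeFinset.card := by
  refine (Finset.card_le_card (t := (unitDistanceGraph N P).edgeFinset.image
    (Sym2.map Subtype.val)) ?_).trans Finset.card_image_le
  intro e he
  obtain ⟨heP, hlen⟩ := Finset.mem_filter.1 he
  induction e using Sym2.ind with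
  | _ x y =>
    obtain ⟨hx, hy⟩ := Finset.mk_mem_sym2_iff.1 heP
    refine Finset.mem_image.2 ⟨s(⟨x, hx⟩, ⟨y, hy⟩), ?_, rfl⟩
    rw [SimpleGraph.mem_edgeFinset, SimpleGraph.mem_edgeSet]
    exact hlen

/-- A second maximizer `y` of `φ` on the unit ball would give `φ (x + y) = 2`, exceeding `N (x +
y)`. -/
theorem IsStrictlyConvexNorm.functional_lt_one {d : ℕ} {N : Seminorm ℝ (Rd d)}
    (hN : IsStrictlyConvexNorm N) {φ : Rd d →ₗ[ℝ] ℝ} (hφ : ∀ y, φ y ≤ N y) {x y : Rd d}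
    (hx : N x = 1) (hφx : φ x = N x) (hy : N y ≤ 1) (hxy : x ≠ y) : φ y < 1 := by
  have h1 := hN.map_add_lt hx.le hy hxy
  have h2 := hφ (x + y)
  rw [map_add, hφx, hx] at h2
  linarith

/-- In a strictly convex norm, sets of diameter at most one with all mutual distances equal to one
form a strictly antipodal family. -/
theorem IsStrictlyConvexNorm.strictlyAntipodal {d : ℕ} {ι : Type*} {N : Seminorm ℝ (Rd d)}
    (hN : IsStrictlyConvexNorm N) {A : ι → Set (Rd d)}
    (hcross : ∀ i j, i ≠ j → ∀ p ∈ A i, ∀ q ∈ A j, N (p - q) = 1)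
    (hle : ∀ i, ∀ p ∈ A i, ∀ q ∈ A i, N (p - q) ≤ 1) : StrictlyAntipodal A := by
  have hle' : ∀ i j, ∀ p ∈ A i, ∀ q ∈ A j, N (p - q) ≤ 1 := by
    intro i j p hp q hq
    by_cases h : i = j
    · subst h
      exact hle i p hp q hq
    · exact (hcross i j h p hp q hq).le
  intro i j hij p hp q hq
  have hqp : N (q - p) = 1 := hcross j i hij.symm q hq p hp
  obtain ⟨φ, hφx, hφ⟩ := N.exists_linearMap_le (q - p)
  refine ⟨φ, ?_⟩
  rintro r ⟨hr, hrn⟩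
  obtain ⟨l, hl⟩ := Set.mem_iUnion.1 hr
  simp only [Set.mem_insert_iff, Set.mem_singleton_iff, not_or] at hrn
  -- Both `q - r` and `r - p` lie in the unit ball and differ from `q - p`, where `φ` is 1.
  have h1 : φ (q - r) < 1 := hN.functional_lt_one hφ hqp hφx (hle' j l q hq r hl)
    fun h => hrn.1 (sub_right_injective h).symm
  have h2 : φ (r - p) < 1 := hN.functional_lt_one hφ hqp hφx (hle' l i r hl p hp)
    fun h => hrn.2 (sub_left_injective h).symm
  rw [hqp] at hφx
  rw [map_sub] at h1 h2 hφx
  constructor <;> linarith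

theorem exists_maxUnitPairs_le_extremalNumber {d k : ℕ} (hd : 1 ≤ d) (hk0 : 1 ≤ k)
    (hk : k + 1 ∉ antipodalSizes d) :
    ∃ t : ℕ, ∀ n, maxUnitPairs d n ≤
      SimpleGraph.extremalNumber n (SimpleGraph.completeEquipartiteGraph (k + 1) t) := by
  classical
  obtain ⟨m, hm⟩ : ∃ m : ℕ, ∀ A : Fin (k + 1) → Set (Rd d), StrictlyAntipodal A →
      ¬ ∀ i, (m : ℕ∞) ≤ (A i).encard := by
    by_contra! hcon
    exact hk hcon
  -- The least class size for which the packing argument yields `m` points of diameter below one.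
  refine ⟨5 ^ d * m + 1, fun n => ?_⟩
  obtain ⟨N, hN, P, hP, hc⟩ := (isGreatest_maxUnitPairs hd n).1
  rw [← hc, ← hP, ← Fintype.card_coe P]
  refine (card_unitPairs_le N P).trans (SimpleGraph.card_edgeFinset_le_extremalNumber ?_)
  rintro ⟨f⟩
  let q : Fin (k + 1) → Fin (5 ^ d * m + 1) → Rd d := fun i j => (f (i, j)).1
  have hq : ∀ i i', i ≠ i' → ∀ j j', N (q i j - q i' j') = 1 := fun i i' hi j j' =>
    f.toHom.map_adj (v := (i, j)) (w := (i', j')) hi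
  have hqinj : ∀ i, Function.Injective (q i) := fun i j j' h =>
    (Prod.mk.inj (f.injective (Subtype.val_injective h))).2
  have hS : ∀ i, ∃ S : Finset (Rd d), S ⊆ Finset.univ.image (q i) ∧ m ≤ S.card ∧
      ∀ x ∈ S, ∀ y ∈ S, N (x - y) < 1 := by
    intro i
    -- Since `k ≥ 1` there is a second class, any point of which is the centre of a unit ball
    -- containing class `i`.
    have : Nontrivial (Fin (k + 1)) := Fin.nontrivial_iff_two_le.2 (by omega)
    obtain ⟨i', hi'⟩ := exists_ne i
    refine N.exists_subset_card_lt_one hN.eq_zero_of_map_eq_zero _ (q i' 0) ?_ m ?_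
    · intro x hx
      obtain ⟨j, -, rfl⟩ := Finset.mem_image.1 hx
      exact (hq i i' hi'.symm j 0).le
    · rw [Finset.card_image_of_injective _ (hqinj i), Finset.card_univ, Fintype.card_fin,
        finrank_euclideanSpace, Fintype.card_fin]
      exact Nat.lt_succ_self _
  choose S hSq hSm hS1 using hS
  refine hm (fun i => (S i : Set (Rd d))) (hN.strictlyAntipodal ?_ ?_) fun i => ?_
  · intro i i' hi x hx y hy
    obtain ⟨j, -, rfl⟩ := Finset.mem_image.1 (hSq i hx)
    obtain ⟨j', -, rfl⟩ := Finset.mem_image.1 (hSq i' hy)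
    exact hq i i' hi j j'
  · exact fun i x hx y hy => (hS1 i x hx y hy).le
  · rw [Set.encard_coe_eq_coe_finsetCard]
    exact_mod_cast hSm i

theorem theorem3 (d : ℕ) (hd : 3 ≤ d) :
    IsGreatest (antipodalSizes d) (antipodalNumber d) ∧
    Tendsto (fun n : ℕ => (maxNonparallelUnitPairs d n : ℝ) / (n : ℝ) ^ 2) atTop
      (𝓝 ((1 / 2 : ℝ) * (1 - 1 / (antipodalNumber d : ℝ)))) ∧
    Tendsto (fun n : ℕ => (maxUnitPairs d n : ℝ) / (n : ℝ) ^ 2) atTop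
      (𝓝 ((1 / 2 : ℝ) * (1 - 1 / (antipodalNumber d : ℝ)))) ∧
    Tendsto (fun n : ℕ => (maxDiameterPairs d n : ℝ) / (n : ℝ) ^ 2) atTop
      (𝓝 ((1 / 2 : ℝ) * (1 - 1 / (antipodalNumber d : ℝ)))) := by
  have hd1 : 1 ≤ d := by omega
  have ha := isGreatest_antipodalNumber hd1
  have ha1 : 1 ≤ antipodalNumber d := ha.2 (one_mem_antipodalSizes hd1)
  obtain ⟨t, ht⟩ := exists_maxUnitPairs_le_extremalNumber hd1 ha1
    fun h => absurd (ha.2 h) (by omega)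
  have hT := tendsto_card_edgeFinset_turanGraph_div_sq ha1
  have hu := fun (ε : ℝ) (hε : 0 < ε) =>
    eventually_extremalNumber_completeEquipartiteGraph_le hε (antipodalNumber d) t
  have hW := card_edgeFinset_turanGraph_le_maxNonparallelUnitPairs hd1 ha1 ha.1
  have hWU := maxNonparallelUnitPairs_le_maxUnitPairs hd1
  exact ⟨ha, tendsto_div_sq_of_le hT hu hW fun n => (hWU n).trans (ht n),
    tendsto_div_sq_of_le hT hu (fun n => (hW n).trans (hWU n)) ht,
    tendsto_div_sq_of_le hT hu (card_edgeFinset_turanGraph_le_maxDiameterPairs hd1 ha1 ha.1)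
      fun n => (maxDiameterPairs_le_maxUnitPairs hd1 n).trans (ht n)⟩
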